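/- Let $\mathbb K$ be a field of characteristic $0$, let $\mathcal S\subset\mathbb Z$ be a finite set with $\max\mathcal S=a\ge 1$ and $\min\mathcal S=-b\le 0$, and let $(\omega_s)_{s\in\mathcal S}$ be weights in $\mathbb K$ with $\omega_a\neq 0$ and $\omega_{-b}\neq 0$. An excursion of length $n$ is a sequence $(s_1,\dots,s_n)\in\mathcal S^n$ all of whose partial sums $s_1+\cdots+s_i$ ($0\le i\le n$) are non-negative and whose total sum is $0$; its height is the maximum of these partial sums. For $k\ge 0$ let $$E^{(k)}=\sum \omega_{s_1}\cdots\omega_{s_n}\,t^n\in\mathbb K[[t]],$$ the sum being over all excursions of height at most $k$. Let $A^{(k)}=(A_{i,j})_{0\le i,j\le k}$ with $A_{i,j}=\omega_{j-i}$ if $j-i\in\mathcal S$ and $A_{i,j}=0$ otherwise, and put $F_0=1$ and $F_{k+1}=\det(1-tA^{(k)})\in\mathbb K[t]$ for $k\ge 0$. Let $\mathcal U=(U_1,\dots,U_{a+b})$ be the roots, listed with multiplicity, of the polynomial $$K(u)=u^b\Bigl(1-t\sum_{s\in\mathcal S}\omega_s u^s\Bigr)$$ of degree $a+b$ in $u$,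 in an extension field $L$ of $\mathbb K((t))$ in which it splits (for instance the field of Puiseux series in $t$ over an algebraic closure of $\mathbb K$). For a partition $\lambda=(\lambda_1\ge\cdots\ge\lambda_n\ge 0)$ let $s_\lambda$ denote the Schur function $$s_\lambda(x_1,\dots,x_n)=\frac{\det\bigl(x_i^{\lambda_j+n-j}\bigr)_{1\le i,j\le n}}{\det\bigl(x_i^{n-j}\bigr)_{1\le i,j\le n}},$$ and let $k^a$ denote the partition with $a$ parts equal to $k$ (completed by zeros). Then the roots $U_1,\dots,U_{a+b}$ are pairwise distinct, and for every $k\ge 0$ one has $F_{k+1}\ne 0$, $s_{(k+1)^a}(\mathcal U)\neq 0$, $$E^{(k)}=\frac{F_k}{F_{k+1}}=\frac{(-1)^{a+1}}{t\omega_a}\,\frac{s_{k^a}(\mathcal U)}{s_{(k+1)^a}(\mathcal U)},$$ and $$F_k=(-1)^{k(a+1)}(t\omega_a)^k\,s_{k^a}(\mathcal U).$$ -/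

import Mathlib

open scoped Polynomial PowerSeries LaurentSeries

namespace DiscreteExcursions

/-- The level `s₁ + ⋯ + sᵢ` reached after the first `i` steps of a walk of length `n`. -/
def level {n : ℕ} (s : Fin n → ℤ) (i : Fin (n + 1)) : ℤ :=
  ∑ j : Fin n with j.castSucc < i, s j

/-- A walk is an excursion if all its levels are non-negative and its final level is `0`. -/
def IsExcursion {n : ℕ} (s : Fin n → ℤ) : Prop :=
  (∀ i, 0 ≤ level s i) ∧ level s (Fin.last n) = 0

/-- A walk has height at most `k` if none of its levels exceeds `k`. -/
def HeightLE {n : ℕ} (s : Fin n → ℤ) (k : ℕ) : Prop :=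
  ∀ i, level s i ≤ (k : ℤ)

instance {n : ℕ} (s : Fin n → ℤ) : Decidable (IsExcursion s) :=
  inferInstanceAs (Decidable ((∀ i, 0 ≤ level s i) ∧ level s (Fin.last n) = 0))

instance {n : ℕ} (s : Fin n → ℤ) (k : ℕ) : Decidable (HeightLE s k) :=
  inferInstanceAs (Decidable (∀ i, level s i ≤ (k : ℤ)))

/-- The excursions of length `n` and height at most `k`, with all steps in `S`. -/
def boundedExcursions (S : Finset ℤ) (k n : ℕ) : Finset (Fin n → ℤ) :=
  (Fintype.piFinset fun _ : Fin n => S).filter fun s => IsExcursion s ∧ HeightLE s k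

noncomputable section

variable {K : Type*} [Field K]

/-- The generating function `E⁽ᵏ⁾ = ∑ ω_{s₁} ⋯ ω_{sₙ} tⁿ` of excursions of height at most `k`
with steps in `S`, a formal power series in `t`. -/
def boundedExcursionSeries (S : Finset ℤ) (ω : ℤ → K) (k : ℕ) : K⟦X⟧ :=
  PowerSeries.mk fun n => ∑ s ∈ boundedExcursions S k n, ∏ i, ω (s i)

/-- The weighted adjacency matrix `A⁽ᵏ⁾` of the steps inside the strip `{0, …, k}`. -/
def adjacency (S : Finset ℤ) (ω : ℤ → K) (k : ℕ) : Matrix (Fin (k + 1)) (Fin (k + 1)) K :=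
  Matrix.of fun i j => if (j : ℤ) - (i : ℤ) ∈ S then ω ((j : ℤ) - (i : ℤ)) else 0

/-- `F₀ = 1` and `F_{k+1} = det (1 - t A⁽ᵏ⁾)`, polynomials in `t`. -/
def F (S : Finset ℤ) (ω : ℤ → K) : ℕ → K[X]
  | 0 => 1
  | k + 1 => (1 - (Polynomial.X : K[X]) • (adjacency S ω k).map Polynomial.C).det

/-- The Laurent polynomial `P(u) = ∑_{s ∈ S} ω_s u^s`, with coefficients viewed in `K[t]`. -/
def stepPolynomial (S : Finset ℤ) (ω : ℤ → K) : LaurentPolynomial K[X] :=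
  ∑ s ∈ S, LaurentPolynomial.C (Polynomial.C (ω s)) * LaurentPolynomial.T s

/-- The kernel `K(u) = u^b (1 - t P(u))`, a polynomial in `u` with coefficients in `K[t]`,
for `-b` a lower bound of `S`; see `toLaurent_kernel`. -/
def kernel (S : Finset ℤ) (ω : ℤ → K) (b : ℕ) : K[X][X] :=
  Polynomial.X ^ b -
    Polynomial.C Polynomial.X *
      ∑ s ∈ S, Polynomial.C (Polynomial.C (ω s)) * Polynomial.X ^ (s + (b : ℤ)).toNat

/-- In the ring of Laurent polynomials in `u`, the kernel is `u^b (1 - t P(u))`. -/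
theorem toLaurent_kernel (S : Finset ℤ) (ω : ℤ → K) (b : ℕ) (hb : ∀ s ∈ S, -(b : ℤ) ≤ s) :
    Polynomial.toLaurent (kernel S ω b) =
      LaurentPolynomial.T (b : ℤ) *
        (1 - LaurentPolynomial.C (Polynomial.X : K[X]) * stepPolynomial S ω) := by
  have key : ∀ s ∈ S,
      Polynomial.toLaurent (Polynomial.C (Polynomial.C (ω s)) *
        (Polynomial.X : K[X][X]) ^ (s + (b : ℤ)).toNat) =
      LaurentPolynomial.T (b : ℤ) *
        (LaurentPolynomial.C (Polynomial.C (ω s)) * LaurentPolynomial.T s) := by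
    intro s hs
    have h := hb s hs
    rw [map_mul, map_pow, Polynomial.toLaurent_C, Polynomial.toLaurent_X, LaurentPolynomial.T_pow,
      mul_left_comm, ← LaurentPolynomial.T_add]
    congr 2
    omega
  rw [kernel, stepPolynomial, map_sub, map_mul, map_sum, Finset.sum_congr rfl key,
    ← Finset.mul_sum, map_pow, Polynomial.toLaurent_X, Polynomial.toLaurent_C,
    LaurentPolynomial.T_pow]
  simp only [mul_one]
  ring

/-- The alternant `a_μ(x₁, …, xₙ) = det (xᵢ ^ μⱼ)`. -/
def alternant {n : ℕ} (x : Fin n → K) (μ : Fin n → ℕ) : K :=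
  (Matrix.of fun i j => x i ^ μ j).det

/-- The staircase `δ = (n-1, n-2, …, 1, 0)`. -/
def staircase (n : ℕ) : Fin n → ℕ :=
  fun j => n - 1 - (j : ℕ)

/-- The Schur function `s_μ(x₁, …, xₙ) = a_{δ+μ} / a_δ`, for a partition `μ₁ ≥ ⋯ ≥ μₙ ≥ 0`,
evaluated at pairwise distinct elements `x₁, …, xₙ` of a field. -/
def schur {n : ℕ} (μ : Fin n → ℕ) (x : Fin n → K) : K :=
  alternant x (staircase n + μ) / alternant x (staircase n)

/-- The rectangular partition `k^a = (k, …, k, 0, …, 0)`, with `a` parts equal to `k`,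
written with `n` parts. -/
def rectangle (n k a : ℕ) : Fin n → ℕ :=
  fun j => if (j : ℕ) < a then k else 0

variable (K) in
/-- The inclusion of `K[[t]]` in an extension field `L` of `K((t))`. -/
def seriesMap (L : Type*) [Field L] [Algebra K⸨X⸩ L] : K⟦X⟧ →+* L :=
  (algebraMap K⸨X⸩ L).comp (algebraMap K⟦X⟧ K⸨X⸩)

variable (K) in
/-- The inclusion of `K[t]` in an extension field `L` of `K((t))`. -/
def polyMap (L : Type*) [Field L] [Algebra K⸨X⸩ L] : K[X] →+* L :=
  (seriesMap K L).comp Polynomial.coeToPowerSeries.ringHom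

end

end DiscreteExcursions

open DiscreteExcursions

/-! The transfer matrix gives `E⁽ᵏ⁾` as the `(0,0)` entry of `(1 - tA⁽ᵏ⁾)⁻¹`. By Cramer's rule this
is `F_k / F_{k+1}`, since deleting the first row and column leaves the same matrix one size smaller
(`boundedExcursionSeries_mul_det`).

The entries of `1 - tA⁽ᵏ⁾` are the coefficients of the kernel along diagonals, so `F_k` is a
Toeplitz determinant (`F_eq_det_toeplitz`). A dual Jacobi–Trudi identity expresses it through the
roots (`alternant_mul_det_toeplitz`): two square matrices, one built from powers of the roots and
one from shifts of the kernel, have a block triangular product.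

The roots are simple (`rootMultiplicity_kernel_le_one`): a multiple root would be algebraic over
`K`, and then so would `t`. -/

namespace DiscreteExcursions

/-! ### Alternants and the dual Jacobi–Trudi identity -/

section Alternant

variable {L : Type*} [Field L]

theorem val_finRotate_pow {n : ℕ} (k : ℕ) (i : Fin n) :
    ((finRotate n ^ k) i : ℕ) = (i + k) % n := by
  induction k with
  | zero => simp [Nat.mod_eq_of_lt i.isLt]
  | succ k ih =>
    obtain ⟨m, rfl⟩ : ∃ m, n = m + 1 := ⟨n - 1, by have := i.isLt; omega⟩
    rw [pow_succ', Equiv.Perm.mul_apply, finRotate_apply, Fin.val_add, ih, Fin.val_one',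
      ← Nat.add_mod, add_assoc]

/-- A rotation of `a + k ≥ 1` points has sign `(-1) ^ (a + k - 1)`, and `k * (k - 1)` is even. -/
theorem sign_finRotate_add_pow (a k : ℕ) :
    Equiv.Perm.sign (finRotate (a + k) ^ k) = (-1) ^ (k * a) := by
  rcases k with _ | k
  · simp
  rw [map_pow, sign_finRotate, ← pow_mul]
  have h : (a + (k + 1) - 1) * (k + 1) = (k + 1) * a + k * (k + 1) := by
    rw [← add_assoc, Nat.add_sub_cancel]; ring
  rw [h, pow_add, (Nat.even_mul_succ_self k).neg_one_pow, mul_one]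

/-- Splits the positions `0, …, a + k + b - 1`: the block of `k` positions starting at `a` is
separated from the other ones. -/
def splitPositions (a b k : ℕ) : (Fin a ⊕ Fin b) ⊕ Fin k ≃ Fin (a + k) ⊕ Fin b :=
  (Equiv.sumAssoc _ _ _).trans <| ((Equiv.refl _).sumCongr (Equiv.sumComm _ _)).trans <|
    (Equiv.sumAssoc _ _ _).symm.trans (finSumFinEquiv.sumCongr (Equiv.refl _))

/-- Moves the block of `k` positions starting at `a` to the front. -/
def moveBlock (a b k : ℕ) : Equiv.Perm (Fin (a + k) ⊕ Fin b) :=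
  (finRotate (a + k) ^ k).sumCongr (Equiv.refl _)

theorem sign_moveBlock (a b k : ℕ) :
    Equiv.Perm.sign (moveBlock a b k) = (-1) ^ (k * a) := by
  rw [moveBlock, Equiv.Perm.sign_sumCongr, sign_finRotate_add_pow]
  simp

/-- The exponents `a + k + b - 1, …, 1, 0`, in decreasing order. -/
def exponent (a b k : ℕ) : Fin (a + k) ⊕ Fin b → ℕ :=
  fun p => a + k + b - 1 - finSumFinEquiv p

/-- The exponents in `δ + k^a` are those below `a + b + k` outside the gap `b, …, b + k - 1`. Those
in `δ` omit the top `k` instead, which is what `moveBlock` achieves. -/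
theorem exponent_split_inl (a b k : ℕ) (j : Fin a ⊕ Fin b) :
    exponent a b k (splitPositions a b k (Sum.inl j)) =
      (staircase (a + b) + rectangle (a + b) k a) (finSumFinEquiv j) := by
  rcases j with j | j <;> simp [exponent, splitPositions, staircase, rectangle] <;> omega

theorem exponent_split_inr (a b k : ℕ) (l : Fin k) :
    exponent a b k (splitPositions a b k (Sum.inr l)) = b + (k - 1 - l) := by
  simp [exponent, splitPositions]; omega

theorem exponent_move_inl (a b k : ℕ) (j : Fin a ⊕ Fin b) :
    exponent a b k (moveBlock a b k (splitPositions a b k (Sum.inl j))) =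
      staircase (a + b) (finSumFinEquiv j) := by
  rcases j with j | j
  · have h : ((j : ℕ) + k) % (a + k) = j + k := Nat.mod_eq_of_lt (by omega)
    simp [exponent, splitPositions, moveBlock, staircase, val_finRotate_pow, h]; omega
  · simp [exponent, splitPositions, moveBlock, staircase]; omega

theorem exponent_move_inr (a b k : ℕ) (l : Fin k) :
    exponent a b k (moveBlock a b k (splitPositions a b k (Sum.inr l))) =
      a + b + (k - 1 - l) := by
  have h : (a + (l : ℕ) + k) % (a + k) = l := by
    rw [show a + (l : ℕ) + k = l + (a + k) by ring, Nat.add_mod_right,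
      Nat.mod_eq_of_lt (by omega)]
  simp [exponent, splitPositions, moveBlock, val_finRotate_pow, h]; omega

/-- Lets a row of powers times a column of coefficients be read as a polynomial evaluation. -/
theorem sum_exponent {M : Type*} [AddCommMonoid M] (a b k : ℕ) (f : ℕ → M) :
    ∑ p, f (exponent a b k p) = ∑ m ∈ Finset.range (a + k + b), f m := by
  rw [← Fin.sum_univ_eq_sum_range, ← Equiv.sum_comp Fin.revPerm,
    ← Equiv.sum_comp finSumFinEquiv]
  refine Finset.sum_congr rfl fun p _ => ?_
  simp only [exponent, Fin.revPerm_apply, Fin.val_rev]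
  congr 1; omega

theorem alternant_eq_det_sum {a b : ℕ} (x : Fin (a + b) → L) (μ : Fin (a + b) → ℕ) :
    alternant x μ = (Matrix.of fun i j : Fin a ⊕ Fin b =>
      x (finSumFinEquiv i) ^ μ (finSumFinEquiv j)).det := by
  rw [alternant, ← Matrix.det_submatrix_equiv_self finSumFinEquiv]
  rfl

theorem alternant_staircase_ne_zero {n : ℕ} {x : Fin n → L} (hx : Function.Injective x) :
    alternant x (staircase n) ≠ 0 := by
  have h : (Matrix.of fun i j => x i ^ staircase n j) =
      (Matrix.vandermonde x).submatrix id Fin.revPerm := by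
    ext i j
    simp only [staircase, Matrix.of_apply, Matrix.submatrix_apply, id, Matrix.vandermonde_apply,
      Fin.revPerm_apply, Fin.val_rev]
    congr 1
    omega
  rw [alternant, h, Matrix.det_permute']
  refine mul_ne_zero ?_ (Matrix.det_vandermonde_ne_zero_iff.2 hx)
  rcases Int.units_eq_one_or (Equiv.Perm.sign (Fin.revPerm : Equiv.Perm (Fin n))) with h | h <;>
    simp [h]

/-- The Toeplitz matrix of size `k` of a polynomial, with the coefficient of degree `b` on the
diagonal. -/
def toeplitz {R : Type*} [Semiring R] (p : R[X]) (b k : ℕ) : Matrix (Fin k) (Fin k) R :=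
  Matrix.of fun i j => if (i : ℕ) ≤ b + j then p.coeff (b + j - i) else 0

/-- The dual Jacobi–Trudi identity for a rectangular partition, in terms of a polynomial of degree
at most `a + b` vanishing at the given points. -/
theorem alternant_mul_det_toeplitz {a b : ℕ} (k : ℕ) (x : Fin (a + b) → L) (p : L[X])
    (hdeg : p.natDegree ≤ a + b) (hp : ∀ i, p.eval (x i) = 0) :
    alternant x (staircase (a + b)) * (toeplitz p b k).det =
      (-1) ^ (k * a) * p.coeff (a + b) ^ k *
        alternant x (staircase (a + b) + rectangle (a + b) k a) := by
  set e := splitPositions a b k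
  set τ := moveBlock a b k
  set E := exponent a b k
  -- `W` evaluates at the points and extracts the coefficients in the gap. The columns of `Q` are
  -- the monomials of degree below `a + b` and the shifts `p * X ^ (k - 1 - l)`.
  set W : Matrix ((Fin a ⊕ Fin b) ⊕ Fin k) (Fin (a + k) ⊕ Fin b) L := Matrix.of fun i q =>
    Sum.elim (fun i => x (finSumFinEquiv i) ^ E q) (fun l => if q = e (Sum.inr l) then 1 else 0) i
  set Q : Matrix (Fin (a + k) ⊕ Fin b) ((Fin a ⊕ Fin b) ⊕ Fin k) L := Matrix.of fun q j =>
    Sum.elim (fun j => if q = τ (e (Sum.inl j)) then 1 else 0)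
      (fun l : Fin k => (p * Polynomial.X ^ (k - 1 - l : ℕ)).coeff (E q)) j
  have hWQ : W * Q = Matrix.fromBlocks (Matrix.of fun i j : Fin a ⊕ Fin b =>
      x (finSumFinEquiv i) ^ staircase (a + b) (finSumFinEquiv j)) 0
      (Matrix.of fun l j => Q (e (Sum.inr l)) (Sum.inl j)) (toeplitz p b k) := by
    ext i j
    rcases i with i | l <;> rcases j with j | l'
    · simp [Matrix.mul_apply, W, Q, E, τ, e, exponent_move_inl]
    · simp only [Matrix.mul_apply, W, Q, Matrix.of_apply, Sum.elim_inl, Sum.elim_inr,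
        Matrix.fromBlocks_apply₁₂, Matrix.zero_apply]
      refine (sum_exponent a b k fun m => x (finSumFinEquiv i) ^ m *
        (p * Polynomial.X ^ (k - 1 - l' : ℕ)).coeff m).trans ?_
      simp_rw [mul_comm (x _ ^ _)]
      rw [← Polynomial.eval_eq_sum_range', Polynomial.eval_mul, hp, zero_mul]
      refine (Polynomial.natDegree_mul_le.trans
        (add_le_add hdeg (Polynomial.natDegree_X_pow_le _))).trans_lt ?_
      omega
    · simp [Matrix.mul_apply, W]
    · simp only [Matrix.mul_apply, W, Q, Matrix.of_apply, Sum.elim_inr, ite_mul, one_mul, zero_mul,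
        Finset.sum_ite_eq', Finset.mem_univ, if_true, Matrix.fromBlocks_apply₂₂, E, e,
        exponent_split_inr, Polynomial.coeff_mul_X_pow', toeplitz]
      have := l.isLt
      have := l'.isLt
      split_ifs <;> first | rfl | omega | (congr 1; omega)
  have hW : (W.submatrix id e).det =
      alternant x (staircase (a + b) + rectangle (a + b) k a) := by
    have : W.submatrix id e = Matrix.fromBlocks (Matrix.of fun i j : Fin a ⊕ Fin b =>
        x (finSumFinEquiv i) ^ (staircase (a + b) + rectangle (a + b) k a) (finSumFinEquiv j))
        (Matrix.of fun i l => W (Sum.inl i) (e (Sum.inr l))) 0 1 := by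
      ext i j
      rcases i with i | l <;> rcases j with j | l' <;>
        simp [W, E, e, exponent_split_inl, Matrix.one_apply, eq_comm]
    rw [this, Matrix.det_fromBlocks_zero₂₁, Matrix.det_one, mul_one, alternant_eq_det_sum]
  have hQ' : ((Q.submatrix τ id).submatrix e id).det = p.coeff (a + b) ^ k := by
    have : (Q.submatrix τ id).submatrix e id = Matrix.fromBlocks 1
        (Matrix.of fun j l => Q (τ (e (Sum.inl j))) (Sum.inr l)) 0
        (Matrix.of fun l l' : Fin k =>
          (p * Polynomial.X ^ (k - 1 - l' : ℕ)).coeff (a + b + (k - 1 - l))) := by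
      ext i j
      rcases i with i | l <;> rcases j with j | l' <;>
        simp [Q, E, τ, e, exponent_move_inr, Matrix.one_apply]
    rw [this, Matrix.det_fromBlocks_zero₂₁, Matrix.det_one, one_mul,
      -- Above the diagonal the coefficient of `p` has degree `a + b + (l' - l) > a + b`; on it,
      -- degree `a + b`.
      Matrix.det_of_isLowerTriangular]
    · simp [Polynomial.coeff_mul_X_pow]
    · intro l l' h
      have h : l < l' := h
      have : (l : ℕ) < l' := h
      rw [Matrix.of_apply, Polynomial.coeff_mul_X_pow', if_pos (by omega)]
      exact Polynomial.coeff_eq_zero_of_natDegree_lt (by omega)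
  have hQ : (Q.submatrix e id).det = (-1) ^ (k * a) * p.coeff (a + b) ^ k := by
    -- The two row orders of `Q` differ by a conjugate of `τ`, which has the same sign.
    have hsub : (Q.submatrix τ id).submatrix e id =
        (Q.submatrix e id).submatrix (e.symm.permCongr τ) id := by
      ext i j
      simp [Equiv.permCongr_apply]
    rw [hsub, Matrix.det_permute, Equiv.Perm.sign_permCongr, sign_moveBlock] at hQ'
    rw [← hQ', ← mul_assoc]
    push_cast
    rw [← mul_pow]
    simp
  rw [alternant_eq_det_sum, ← Matrix.det_fromBlocks_zero₁₂, ← hWQ,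
    ← Matrix.submatrix_id_id (W * Q), ← Matrix.submatrix_mul_equiv W Q id e id, Matrix.det_mul,
    hW, hQ, mul_comm]

end Alternant

/-! ### Transfer matrix for walks in a strip -/

section Walks

variable {K : Type*} [Field K]

theorem level_zero {n : ℕ} (s : Fin n → ℤ) : level s 0 = 0 := by
  simp [level]

theorem level_cons_succ {n : ℕ} (x : ℤ) (s : Fin n → ℤ) (i : Fin (n + 1)) :
    level (Fin.cons x s : Fin (n + 1) → ℤ) i.succ = x + level s i := by
  simp only [level, Finset.sum_filter]
  rw [Fin.sum_univ_succ]
  simp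

/-- The walks of length `n` with steps in `S` that start at level `i`, end at level `j` and stay
in the strip `{0, …, k}`. -/
def stripWalks (S : Finset ℤ) (k n : ℕ) (i j : ℤ) : Finset (Fin n → ℤ) :=
  (Fintype.piFinset fun _ : Fin n => S).filter fun s =>
    (∀ m, 0 ≤ i + level s m ∧ i + level s m ≤ k) ∧ i + level s (Fin.last n) = j

theorem boundedExcursions_eq (S : Finset ℤ) (k n : ℕ) :
    boundedExcursions S k n = stripWalks S k n 0 0 := by
  ext s
  simp only [boundedExcursions, stripWalks, Finset.mem_filter, zero_add, forall_and]
  rw [IsExcursion, HeightLE]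
  tauto

theorem cons_mem_stripWalks {S : Finset ℤ} {k n : ℕ} {i j x : ℤ} {s : Fin n → ℤ} :
    (Fin.cons x s : Fin (n + 1) → ℤ) ∈ stripWalks S k (n + 1) i j ↔
      (0 ≤ i ∧ i ≤ k) ∧ x ∈ S ∧ s ∈ stripWalks S k n (i + x) j := by
  simp only [stripWalks, Finset.mem_filter, Fintype.mem_piFinset, Fin.forall_fin_succ (n := n),
    Fin.forall_fin_succ (n := n + 1), Fin.cons_zero, Fin.cons_succ, level_zero, add_zero,
    ← Fin.succ_last, level_cons_succ, add_assoc]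
  tauto

theorem stripWalks_eq_empty {S : Finset ℤ} {k n : ℕ} {i j : ℤ} (h : ¬(0 ≤ i ∧ i ≤ k)) :
    stripWalks S k n i j = ∅ := by
  refine Finset.filter_eq_empty_iff.2 fun s _ hs => h ?_
  simpa [level_zero] using hs.1 0

/-- First-step decomposition. Without `hi` the left side is an empty sum, while the right side need
not vanish. -/
theorem sum_stripWalks_succ (S : Finset ℤ) (ω : ℤ → K) (k n : ℕ) {i j : ℤ}
    (hi : 0 ≤ i ∧ i ≤ k) :
    ∑ s ∈ stripWalks S k (n + 1) i j, ∏ m, ω (s m) =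
      ∑ x ∈ S, ω x * ∑ s ∈ stripWalks S k n (i + x) j, ∏ m, ω (s m) := by
  simp_rw [Finset.mul_sum]
  rw [Finset.sum_sigma']
  refine Finset.sum_bij' (fun s _ => ⟨s 0, Fin.tail s⟩) (fun y _ => Fin.cons y.1 y.2) ?_ ?_ ?_ ?_ ?_
  · intro s hs
    rw [← Fin.cons_self_tail s, cons_mem_stripWalks] at hs
    simpa using hs.2
  · intro y hy
    rw [cons_mem_stripWalks]
    exact ⟨hi, by simpa using hy⟩
  · intro s _
    simp
  · intro y _
    simp
  · intro s _
    simp [Fin.prod_univ_succ, Fin.tail]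

theorem adjacency_pow_apply (S : Finset ℤ) (ω : ℤ → K) (k n : ℕ) (i j : Fin (k + 1)) :
    (adjacency S ω k ^ n) i j = ∑ s ∈ stripWalks S k n i j, ∏ m, ω (s m) := by
  induction n generalizing i with
  | zero =>
    have hi : ((i : ℕ) : ℤ) ≤ k := by have := i.isLt; omega
    by_cases h : i = j
    · subst h
      simp [stripWalks, level_zero, Finset.filter_true_of_mem, hi, Subsingleton.elim (_ : Fin 1) 0]
    · have h' : ((i : ℕ) : ℤ) ≠ (j : ℕ) := by
        simpa [Fin.ext_iff] using h
      simp [stripWalks, level_zero, Finset.filter_false_of_mem, h, h',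
        Subsingleton.elim (_ : Fin 1) 0]
  | succ n ih =>
    rw [pow_succ', Matrix.mul_apply, sum_stripWalks_succ S ω k n (by have := i.isLt; omega)]
    refine Finset.sum_bij_ne_zero (fun l _ _ => (l : ℤ) - i) ?_ ?_ ?_ ?_
    · intro l _ hl
      by_contra h
      simp [adjacency, h] at hl
    · intro l _ _ l' _ _ h
      ext
      omega
    · intro x hx hne
      have hx' : 0 ≤ (i : ℤ) + x ∧ (i : ℤ) + x ≤ k := by
        by_contra h
        simp [stripWalks_eq_empty h] at hne
      obtain ⟨l, hl⟩ := Int.eq_ofNat_of_zero_le hx'.1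
      have hlx : (l : ℤ) - i = x := by omega
      refine ⟨⟨l, by omega⟩, Finset.mem_univ _, ?_, hlx⟩
      rw [ih]
      simpa [adjacency, hlx, hx, hl] using hne
    · intro l _ hl
      have h : (l : ℤ) - i ∈ S := by
        by_contra h
        simp [adjacency, h] at hl
      rw [ih]
      simp [adjacency, h]

theorem boundedExcursionSeries_mul_det (S : Finset ℤ) (ω : ℤ → K) (k : ℕ) :
    boundedExcursionSeries S ω k * (F S ω (k + 1) : K⟦X⟧) = (F S ω k : K⟦X⟧) := by
  set A := adjacency S ω k
  set M : Matrix (Fin (k + 1)) (Fin (k + 1)) K⟦X⟧ :=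
    1 - (PowerSeries.X : K⟦X⟧) • A.map PowerSeries.C
  set G : Matrix (Fin (k + 1)) (Fin (k + 1)) K⟦X⟧ :=
    Matrix.of fun i j => PowerSeries.mk fun n => (A ^ n) i j
  have hG : G * M = 1 := by
    ext i j n
    rcases n with _ | n
    · simp [M, G, mul_sub, Matrix.mul_apply, Matrix.one_apply, apply_ite]
    · simp [M, G, mul_sub, Matrix.mul_apply, Matrix.one_apply, apply_ite, pow_succ,
        mul_left_comm _ PowerSeries.X, PowerSeries.coeff_succ_X_mul]
  have hM (m : ℕ) : (F S ω (m + 1) : K⟦X⟧) =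
      (1 - (PowerSeries.X : K⟦X⟧) • (adjacency S ω m).map PowerSeries.C).det := by
    rw [F, ← Polynomial.coeToPowerSeries.ringHom_apply, RingHom.map_det]
    congr 1
    ext1 i j
    simp [Matrix.one_apply, apply_ite]
    exact mul_comm _ _
  -- Entries depend only on `j - i`, so the minor is the matrix of the strip of height one less.
  have hadj : M.adjugate 0 0 = (F S ω k : K⟦X⟧) := by
    rw [Matrix.adjugate_fin_succ_eq_det_submatrix]
    rcases k with _ | k
    · simp [F]
    · rw [hM]
      simp only [Fin.val_zero, add_zero, pow_zero, one_mul]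
      congr 1
      ext1 i j
      simp [M, A, adjacency, Matrix.one_apply]
  have hE : boundedExcursionSeries S ω k = G 0 0 := by
    ext n
    simp [boundedExcursionSeries, G, A, adjacency_pow_apply, boundedExcursions_eq]
  have h : G * (M * M.adjugate) = M.adjugate := by rw [← mul_assoc, hG, one_mul]
  rw [Matrix.mul_adjugate] at h
  rw [hE, hM, ← hadj, ← h]
  rw [Matrix.mul_smul, Matrix.mul_one, Matrix.smul_apply, smul_eq_mul, mul_comm]

theorem F_ne_zero (S : Finset ℤ) (ω : ℤ → K) (k : ℕ) : F S ω k ≠ 0 := by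
  rcases k with _ | k
  · simp [F]
  · intro h
    -- At `t = 0` the matrix is the identity.
    have h0 := congrArg (Polynomial.evalRingHom 0) h
    rw [F, RingHom.map_det, map_zero] at h0
    have h1 : (Polynomial.evalRingHom (0 : K)).mapMatrix
        (1 - (Polynomial.X : K[X]) • (adjacency S ω k).map Polynomial.C) = 1 := by
      ext i j
      simp [Matrix.one_apply, apply_ite]
    simp [h1] at h0

end Walks

/-! ### The kernel and its Toeplitz determinants -/

section Kernel

variable {K : Type*} [Field K]

/-- The polynomial `u^b P(u)`, with coefficients in the base field. -/
noncomputable def shiftedStepPolynomial (S : Finset ℤ) (ω : ℤ → K) (b : ℕ) : K[X] :=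
  ∑ s ∈ S, Polynomial.C (ω s) * Polynomial.X ^ (s + (b : ℤ)).toNat

theorem coeff_shiftedStepPolynomial {S : Finset ℤ} (ω : ℤ → K) {b : ℕ}
    (hb : ∀ s ∈ S, -(b : ℤ) ≤ s) (m : ℕ) :
    (shiftedStepPolynomial S ω b).coeff m = if (m : ℤ) - b ∈ S then ω (m - b) else 0 := by
  have h : ∀ s ∈ S, (if m = (s + (b : ℤ)).toNat then ω s else 0) =
      if s = (m : ℤ) - b then ω (m - b) else 0 := by
    intro s hs
    have := hb s hs
    by_cases h : s = (m : ℤ) - b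
    · rw [if_pos (by omega), if_pos h, h]
    · rw [if_neg (by omega), if_neg h]
  rw [shiftedStepPolynomial, Polynomial.finsetSum_coeff]
  simp_rw [Polynomial.coeff_C_mul_X_pow]
  rw [Finset.sum_congr rfl h, Finset.sum_ite_eq']

theorem kernel_eq (S : Finset ℤ) (ω : ℤ → K) (b : ℕ) :
    kernel S ω b = Polynomial.X ^ b -
      Polynomial.C Polynomial.X * (shiftedStepPolynomial S ω b).map Polynomial.C := by
  simp [kernel, shiftedStepPolynomial, Polynomial.map_sum]

theorem coeff_kernel {S : Finset ℤ} (ω : ℤ → K) {b : ℕ} (hb : ∀ s ∈ S, -(b : ℤ) ≤ s) (m : ℕ) :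
    (kernel S ω b).coeff m = (if m = b then 1 else 0) -
      Polynomial.X * (if (m : ℤ) - b ∈ S then Polynomial.C (ω (m - b)) else 0) := by
  rw [kernel_eq, Polynomial.coeff_sub, Polynomial.coeff_X_pow, Polynomial.coeff_C_mul,
    Polynomial.coeff_map, coeff_shiftedStepPolynomial ω hb, apply_ite Polynomial.C, map_zero]

theorem F_eq_det_toeplitz {S : Finset ℤ} (ω : ℤ → K) {b : ℕ} (hb : ∀ s ∈ S, -(b : ℤ) ≤ s)
    (k : ℕ) : F S ω k = (toeplitz (kernel S ω b) b k).det := by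
  rcases k with _ | k
  · simp [F]
  · rw [F]
    congr 1
    ext1 i j
    have hij : (i = j) ↔ (i : ℕ) = j := Fin.ext_iff
    by_cases h : (i : ℕ) ≤ b + j
    · have h1 : ((b + j - i : ℕ) : ℤ) - b = (j : ℤ) - i := by omega
      have h2 : b + j - (i : ℕ) = b ↔ (i : ℕ) = j := by omega
      simp only [toeplitz, coeff_kernel ω hb, adjacency, Matrix.sub_apply, Matrix.smul_apply,
        Matrix.map_apply, Matrix.of_apply, Matrix.one_apply, smul_eq_mul, h, h1, h2, hij, if_true,
        apply_ite Polynomial.C, map_zero]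
    · have h1 : (j : ℤ) - i ∉ S := fun h' => by have := hb _ h'; omega
      have h2 : (i : ℕ) ≠ j := by omega
      simp [toeplitz, h, adjacency, hij, h1, h2]

theorem natDegree_kernel_le {S : Finset ℤ} (ω : ℤ → K) {a b : ℕ}
    (hb : ∀ s ∈ S, -(b : ℤ) ≤ s) (ha : ∀ s ∈ S, s ≤ (a : ℤ)) :
    (kernel S ω b).natDegree ≤ a + b := by
  refine Polynomial.natDegree_le_iff_coeff_eq_zero.2 fun m hm => ?_
  have h : (m : ℤ) - b ∉ S := fun h => by have := ha _ h; omega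
  simp [coeff_kernel ω hb, h, show m ≠ b by omega]

/-! ### Simplicity of the roots and the Schur function formula -/

variable {L : Type*} [Field L]

/-- If `z` is a double root of `X ^ b - t f`, then `z` is a root of `X f' - b f`, and is
algebraic over the base field. -/
theorem isAlgebraic_of_double_root [Algebra K L] {f : K[X]} {b : ℕ} {t z : L} (ht : t ≠ 0)
    (hf : Polynomial.X * Polynomial.derivative f - Polynomial.C (b : K) * f ≠ 0)
    (h₀ : z ^ b = t * Polynomial.aeval z f)
    (h₁ : b * z ^ (b - 1) = t * Polynomial.aeval z (Polynomial.derivative f)) :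
    IsAlgebraic K z := by
  refine ⟨_, hf, mul_left_cancel₀ ht ?_⟩
  have hb : (b : L) * z ^ (b - 1) * z = b * z ^ b := by
    rcases b with _ | b
    · simp
    · rw [Nat.add_sub_cancel, pow_succ, mul_assoc]
  simp only [map_sub, map_mul, Polynomial.aeval_X, map_natCast]
  linear_combination z * (-h₁) + b * h₀ + hb

variable [Algebra K⸨X⸩ L]

theorem seriesMap_injective : Function.Injective (seriesMap K L) :=
  (algebraMap K⸨X⸩ L).injective.comp (FaithfulSMul.algebraMap_injective K⟦X⟧ K⸨X⸩)

theorem polyMap_injective : Function.Injective (polyMap K L) :=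
  seriesMap_injective.comp (Polynomial.coe_injective K)

theorem rootMultiplicity_kernel_le_one [CharZero K] {S : Finset ℤ} {ω : ℤ → K} {a b : ℕ}
    (ha : 0 < a) (hb : ∀ s ∈ S, -(b : ℤ) ≤ s) (haS : (a : ℤ) ∈ S) (hbS : -(b : ℤ) ∈ S)
    (hωa : ω a ≠ 0) (hωb : ω (-b) ≠ 0) (z : L) :
    ((kernel S ω b).map (polyMap K L)).rootMultiplicity z ≤ 1 := by
  set φ := polyMap K L
  have hφ : Function.Injective φ := polyMap_injective
  set f := shiftedStepPolynomial S ω b with hf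
  let _ : Algebra K L := (φ.comp Polynomial.C).toAlgebra
  have hmap : (kernel S ω b).map φ =
      Polynomial.X ^ b - Polynomial.C (φ Polynomial.X) * f.map (algebraMap K L) := by
    rw [kernel_eq, Polynomial.map_sub, Polynomial.map_mul, Polynomial.map_map]
    simp [f, RingHom.algebraMap_toAlgebra]
  have hcoeff : (kernel S ω b).coeff 0 ≠ 0 := by
    intro h
    have h' := congrArg (Polynomial.coeff · 1) h
    -- The constant term in `u` is `1 - t ω₀` if `b = 0`, and `-t ω_{-b}` otherwise.
    rcases b with _ | b
    · have h0 := congrArg (Polynomial.coeff · 0) h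
      have hS : (0 : ℤ) ∈ S := by simpa using hbS
      simp [coeff_kernel ω hb, hS] at h0
    · simp_all [coeff_kernel ω hb]
  have hne : (kernel S ω b).map φ ≠ 0 := by
    rw [Ne, Polynomial.map_eq_zero_iff hφ]
    intro h
    simp [h] at hcoeff
  by_contra! hlt
  obtain ⟨h₀, h₁⟩ := (Polynomial.one_lt_rootMultiplicity_iff_isRoot hne).1 hlt
  have hz : z ≠ 0 := by
    rintro rfl
    rw [Polynomial.IsRoot.def, ← Polynomial.coeff_zero_eq_eval_zero, Polynomial.coeff_map] at h₀
    exact hcoeff (hφ (h₀.trans (map_zero φ).symm))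
  have ht : φ Polynomial.X ≠ 0 := by
    rw [Ne, map_eq_zero_iff φ hφ]
    exact Polynomial.X_ne_zero
  rw [hmap] at h₀ h₁
  simp only [Polynomial.IsRoot.def, Polynomial.derivative_sub, Polynomial.derivative_X_pow,
    Polynomial.derivative_C_mul, Polynomial.derivative_map, Polynomial.eval_sub,
    Polynomial.eval_mul, Polynomial.eval_pow, Polynomial.eval_X, Polynomial.eval_C,
    Polynomial.eval_map_algebraMap, sub_eq_zero] at h₀ h₁
  have hfne : Polynomial.X * Polynomial.derivative f - Polynomial.C (b : K) * f ≠ 0 := by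
    intro h
    -- In degree `a + b` the coefficient is `(a + b) ω_a - b ω_a = a ω_a`, nonzero in characteristic
    -- zero.
    have h' := congrArg (Polynomial.coeff · (a - 1 + b + 1)) h
    simp only [Polynomial.coeff_sub, Polynomial.coeff_X_mul, Polynomial.coeff_derivative,
      Polynomial.coeff_C_mul, Polynomial.coeff_zero] at h'
    rw [show a - 1 + b + 1 = a + b by omega, hf, coeff_shiftedStepPolynomial ω hb] at h'
    have h2 : ((a - 1 + b : ℕ) : K) + 1 = a + b := by
      rw [← Nat.cast_succ, ← Nat.cast_add]; congr 1; omega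
    rw [h2] at h'
    have h3 : (a : K) * ω a = 0 := by
      simp [haS] at h'
      linear_combination h'
    simp [hωa, ha.ne'] at h3
  have hzalg : IsAlgebraic K z := isAlgebraic_of_double_root ht hfne h₀ h₁
  have hfz : Polynomial.aeval z f ≠ 0 := by
    intro h
    rw [h, mul_zero] at h₀
    exact pow_ne_zero b hz h₀
  -- Here `t = z ^ b / f(z)` with `z` algebraic.
  have htalg : IsAlgebraic K (φ Polynomial.X) := by
    have hfalg : IsAlgebraic K (Polynomial.aeval z f) :=
      (IsIntegral.of_mem_of_fg _ hzalg.isIntegral.fg_adjoin_singleton _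
        (Polynomial.aeval_mem_adjoin_singleton K z)).isAlgebraic
    rw [eq_div_of_mul_eq hfz h₀.symm, div_eq_mul_inv]
    exact (hzalg.pow b).mul hfalg.inv
  let ψ : K[X] →ₐ[K] L := ⟨φ, fun _ => rfl⟩
  exact Polynomial.transcendental_X K ((isAlgebraic_algHom_iff ψ hφ).1 htalg)

/-- The leading coefficient `-t ω_a` contributes `(-1) ^ k`, which joins the `(-1) ^ (k * a)` of the
Jacobi–Trudi identity. -/
theorem polyMap_F {S : Finset ℤ} {ω : ℤ → K} {a b : ℕ} (ha : 0 < a)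
    (hb : ∀ s ∈ S, -(b : ℤ) ≤ s) (ha' : ∀ s ∈ S, s ≤ (a : ℤ)) (haS : (a : ℤ) ∈ S)
    {U : Fin (a + b) → L} (hinj : Function.Injective U)
    (hU : ∀ i, ((kernel S ω b).map (polyMap K L)).eval (U i) = 0) (k : ℕ) :
    polyMap K L (F S ω k) =
      (-1) ^ (k * (a + 1)) * polyMap K L (Polynomial.X * Polynomial.C (ω (a : ℤ))) ^ k *
        schur (rectangle (a + b) k a) U := by
  have h := alternant_mul_det_toeplitz k U _
    ((Polynomial.natDegree_map_le).trans (natDegree_kernel_le ω hb ha')) hU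
  have hT : toeplitz ((kernel S ω b).map (polyMap K L)) b k =
      (polyMap K L).mapMatrix (toeplitz (kernel S ω b) b k) := by
    ext i j
    simp only [toeplitz, Matrix.of_apply, RingHom.mapMatrix_apply, Matrix.map_apply,
      Polynomial.coeff_map]
    split_ifs <;> simp
  have hc : ((kernel S ω b).map (polyMap K L)).coeff (a + b) =
      -polyMap K L (Polynomial.X * Polynomial.C (ω (a : ℤ))) := by
    rw [Polynomial.coeff_map, coeff_kernel ω hb]
    simp [haS, ha.ne']
  rw [hT, ← RingHom.map_det, ← F_eq_det_toeplitz ω hb, hc] at h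
  have hne : alternant U (staircase (a + b)) ≠ 0 := alternant_staircase_ne_zero hinj
  rw [schur, mul_div_assoc', eq_div_iff hne, mul_comm, h, neg_pow (polyMap K L _)]
  ring

end Kernel

end DiscreteExcursions

theorem mainTheorem2 {K : Type*} [Field K] [CharZero K]
    (S : Finset ℤ) (ω : ℤ → K) (a b : ℕ) (ha : 0 < a)
    (hmax : IsGreatest (S : Set ℤ) (a : ℤ)) (hmin : IsLeast (S : Set ℤ) (-(b : ℤ)))
    (hωa : ω (a : ℤ) ≠ 0) (hωb : ω (-(b : ℤ)) ≠ 0)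
    {L : Type*} [Field L] [Algebra K⸨X⸩ L]
    (U : Fin (a + b) → L)
    (hU : ((kernel S ω b).map (polyMap K L)).roots = Finset.univ.val.map U) :
    -- the roots are distinct, so that the quotients defining Schur functions are genuine
    Function.Injective U ∧
    ∀ k : ℕ,
      F S ω (k + 1) ≠ 0 ∧
      schur (rectangle (a + b) (k + 1) a) U ≠ 0 ∧
      seriesMap K L (boundedExcursionSeries S ω k) =
        polyMap K L (F S ω k) / polyMap K L (F S ω (k + 1)) ∧
      polyMap K L (F S ω k) / polyMap K L (F S ω (k + 1)) =
        (-1) ^ (a + 1) / polyMap K L (Polynomial.X * Polynomial.C (ω (a : ℤ))) *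
          (schur (rectangle (a + b) k a) U / schur (rectangle (a + b) (k + 1) a) U) ∧
      polyMap K L (F S ω k) =
        (-1) ^ (k * (a + 1)) * polyMap K L (Polynomial.X * Polynomial.C (ω (a : ℤ))) ^ k *
          schur (rectangle (a + b) k a) U := by
  
  have hbS : ∀ s ∈ S, -(b : ℤ) ≤ s := fun s hs => hmin.2 (Finset.mem_coe.2 hs)
  have haS : ∀ s ∈ S, s ≤ (a : ℤ) := fun s hs => hmax.2 (Finset.mem_coe.2 hs)
  have hamem : (a : ℤ) ∈ S := Finset.mem_coe.1 hmax.1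
  have hinj : Function.Injective U := by
    have hnodup : (Finset.univ.val.map U).Nodup := by
      classical
      rw [← hU, Multiset.nodup_iff_count_le_one]
      intro z
      rw [Polynomial.count_roots]
      exact rootMultiplicity_kernel_le_one ha hbS hamem (Finset.mem_coe.1 hmin.1) hωa hωb z
    exact fun i j h => Multiset.inj_on_of_nodup_map hnodup i (Finset.mem_univ i) j
      (Finset.mem_univ j) h
  have hroot (i : Fin (a + b)) : ((kernel S ω b).map (polyMap K L)).eval (U i) = 0 := by
    have h : U i ∈ ((kernel S ω b).map (polyMap K L)).roots := by
      rw [hU]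
      exact Multiset.mem_map_of_mem U (Finset.mem_univ i)
    exact Polynomial.isRoot_of_mem_roots h
  have hF := polyMap_F ha hbS haS hamem hinj hroot
  have hne (k : ℕ) : polyMap K L (F S ω k) ≠ 0 :=
    (map_ne_zero_iff _ polyMap_injective).2 (F_ne_zero S ω k)
  refine ⟨hinj, fun k => ?_⟩
  have hs : schur (rectangle (a + b) (k + 1) a) U ≠ 0 := fun h =>
    hne (k + 1) (by rw [hF, h, mul_zero])
  have ht : polyMap K L (Polynomial.X * Polynomial.C (ω (a : ℤ))) ≠ 0 :=
    (map_ne_zero_iff _ polyMap_injective).2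
      (mul_ne_zero Polynomial.X_ne_zero (Polynomial.C_ne_zero.2 hωa))
  refine ⟨F_ne_zero S ω (k + 1), hs, ?_, ?_, hF k⟩
  · rw [eq_div_iff (hne (k + 1))]
    exact (map_mul (seriesMap K L) _ _).symm.trans
      (congrArg (seriesMap K L) (boundedExcursionSeries_mul_det S ω k))
  · have hsq : ((-1 : L) ^ (a + 1)) * (-1) ^ (a + 1) = 1 := by
      rw [← mul_pow]; simp
    rw [div_eq_iff (hne (k + 1)), hF k, hF (k + 1), add_mul, one_mul, pow_add,
      pow_succ (polyMap K L _)]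
    field_simp
    linear_combination -(-1) ^ (k * (a + 1)) * schur (rectangle (a + b) k a) U * hsq
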